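/- Let $0<p\le 1$ and let $A$ be a complex associative algebra (not necessarily unital) equipped with a submultiplicative $p$-homogeneous norm $\|\cdot\|$, that is, a map $\|\cdot\|:A\to[0,\infty)$ such that for all $a,b\in A$ and $\alpha\in\mathbb{C}$ one has $\|a+b\|\le\|a\|+\|b\|$, $\|\alpha a\|=|\alpha|^p\|a\|$, $\|ab\|\le\|a\|\,\|b\|$, and $\|a\|=0$ only if $a=0$. For $a\in A$ let $$|a|=\inf\Big\{\sum_{i=1}^n\|a_i\|^{1/p}\;:\; n\ge 1,\ a_1,\dots,a_n\in A,\ a=\sum_{i=1}^n a_i\Big\}$$ be the support seminorm of $\|\cdot\|$. (1) If $m>0$ is a constant such that $\|a\|^2\le m\|a^2\|$ for all $a\in A$, then for all $a\in A$ $$|a|\le\|a\|^{1/p}\le m^{1/p}|a|\qquad\text{and}\qquad |a|^2\le m^{2/p}|a^2|.$$ (2) If $\|a^2\|=\|a\|^2$ for all $a\in A$, then $|a|=\|a\|^{1/p}$ for all $a\in A$. -/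

import Mathlib

/-- A `p`-homogeneous seminorm on a complex vector space. -/
structure IsPHomogeneousSeminorm {A : Type*} [AddCommGroup A] [Module ℂ A]
    (p : ℝ) (N : A → ℝ) : Prop where
  nonneg : ∀ a, 0 ≤ N a
  add_le : ∀ a b, N (a + b) ≤ N a + N b
  smul_eq : ∀ (c : ℂ) (a : A), N (c • a) = ‖c‖ ^ p * N a

/-- `(A, N)` is a complex `p`-normed algebra: `0 < p ≤ 1` and `N` is a submultiplicative
`p`-homogeneous norm on the complex associative algebra `A`, which need not be unital. -/
structure IsPNormedAlgebra (A : Type*) [NonUnitalRing A] [Module ℂ A]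
    [IsScalarTower ℂ A A] [SMulCommClass ℂ A A] (p : ℝ) (N : A → ℝ) : Prop
    extends IsPHomogeneousSeminorm p N where
  p_pos : 0 < p
  p_le_one : p ≤ 1
  mul_le : ∀ a b, N (a * b) ≤ N a * N b
  eq_zero_of_map_eq_zero : ∀ a, N a = 0 → a = 0

/-- The values `∑ N(aᵢ)^(1/p)` over all finite decompositions `a = ∑ aᵢ`. -/
def supportValues {A : Type*} [AddCommMonoid A] (p : ℝ) (N : A → ℝ) (a : A) : Set ℝ :=
  {s | ∃ n : ℕ, 1 ≤ n ∧ ∃ b : Fin n → A, a = ∑ i, b i ∧ s = ∑ i, N (b i) ^ (1 / p)}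

/-- The support seminorm of `N`: the infimum of `∑ N(aᵢ)^(1/p)` over all finite decompositions
`a = ∑ aᵢ`. -/
noncomputable def supportSeminorm {A : Type*} [AddCommMonoid A] (p : ℝ) (N : A → ℝ) (a : A) : ℝ :=
  sInf (supportValues p N a)

/-- The infimum is over a non-empty set. -/
theorem supportValues_nonempty {A : Type*} [AddCommMonoid A] (p : ℝ) (N : A → ℝ) (a : A) :
    (supportValues p N a).Nonempty :=
  ⟨N a ^ (1 / p), 1, le_rfl, fun _ => a, by simp, by simp⟩

/-- The infimum is over a set bounded below by `0`. -/
theorem supportValues_bddBelow {A : Type*} [AddCommMonoid A] (p : ℝ) (N : A → ℝ)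
    (hN : ∀ a, 0 ≤ N a) (a : A) : BddBelow (supportValues p N a) := by
  refine ⟨0, ?_⟩
  rintro s ⟨n, -, b, -, rfl⟩
  exact Finset.sum_nonneg fun i _ => Real.rpow_nonneg (hN _) _

open Finset Filter Topology

namespace IsPHomogeneousSeminorm

variable {V : Type*} [AddCommGroup V] [Module ℂ V] {p : ℝ} {N : V → ℝ}

theorem map_zero (hN : IsPHomogeneousSeminorm p N) (hp : 0 < p) : N 0 = 0 := by
  have := hN.smul_eq 0 0
  rwa [norm_zero, Real.zero_rpow hp.ne', zero_mul, smul_zero] at this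

theorem sum_le (hN : IsPHomogeneousSeminorm p N) (hp : 0 < p) {ι : Type*} (s : Finset ι)
    (f : ι → V) : N (∑ i ∈ s, f i) ≤ ∑ i ∈ s, N (f i) := by
  classical
  induction s using Finset.induction_on with
  | empty => simp [hN.map_zero hp]
  | insert i s hi ih =>
    rw [sum_insert hi, sum_insert hi]
    exact (hN.add_le _ _).trans (by gcongr)

theorem smul_of_norm_eq_one (hN : IsPHomogeneousSeminorm p N) {c : ℂ} (hc : ‖c‖ = 1) (x : V) :
    N (c • x) = N x := by
  rw [hN.smul_eq, hc, Real.one_rpow, one_mul]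

/-- A Cauchy estimate for the coefficients of a vector-valued polynomial, obtained by averaging
over the roots of unity. -/
theorem coeff_le (hN : IsPHomogeneousSeminorm p N) (hp : 0 < p) (c : ℕ → V) {M : ℕ} (t : ℂ)
    {K : ℝ} (hK : ∀ z : ℂ, ‖z‖ = ‖t‖ → N (∑ i ∈ range M, z ^ i • c i) ≤ K)
    {j : ℕ} (hj : j < M) : (‖t‖ ^ j) ^ p * N (c j) ≤ M * K := by
  have hM : M ≠ 0 := by omega
  have hω := Complex.isPrimitiveRoot_exp M hM
  set ω := Complex.exp (2 * Real.pi * Complex.I / M) with hωdef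
  have hωn : ‖ω‖ = 1 := hω.norm'_eq_one hM
  have hroot : ∀ i ∈ range M, ∑ k ∈ range M, (ω ^ (i + (M - j))) ^ k = if i = j then (M : ℂ) else 0 := by
    intro i hi
    rw [mem_range] at hi
    split_ifs with h
    · rw [h, show j + (M - j) = M by omega, hω.pow_eq_one]
      simp
    · have h1 : ω ^ (i + (M - j)) ≠ 1 := by
        rw [Ne, hω.pow_eq_one_iff_dvd]
        rintro ⟨d, hd⟩
        rcases d with _ | _ | d
        · omega
        · omega
        · have : M * (d + 1 + 1) = M * d + 2 * M := by ring
          have := Nat.zero_le (M * d)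
          omega
      rw [geom_sum_eq h1, ← pow_mul, mul_comm, pow_mul, hω.pow_eq_one]
      simp
  have key : ∑ k ∈ range M, (ω ^ ((M - j) * k)) • ∑ i ∈ range M, (t * ω ^ k) ^ i • c i
      = ((M : ℂ) * t ^ j) • c j := by
    simp_rw [smul_sum, smul_smul]
    rw [sum_comm]
    calc _ = ∑ i ∈ range M, (t ^ i * (if i = j then (M : ℂ) else 0)) • c i := by
          refine sum_congr rfl fun i hi => ?_
          rw [← sum_smul, ← hroot i hi, mul_sum]
          congr 1
          refine sum_congr rfl fun k _ => ?_
          rw [mul_pow, ← pow_mul, ← pow_mul]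
          ring
      _ = _ := by
          rw [sum_eq_single_of_mem j (mem_range.2 hj)]
          · simp [mul_comm]
          · intro i _ hi
            simp [hi]
  have h1 : N (((M : ℂ) * t ^ j) • c j) ≤ M * K := by
    rw [← key]
    refine (hN.sum_le hp _ _).trans ?_
    calc _ ≤ ∑ k ∈ range M, K := by
          refine sum_le_sum fun k _ => ?_
          rw [hN.smul_of_norm_eq_one (by simp [hωn])]
          exact hK _ (by simp [hωn])
      _ = _ := by simp
  rw [hN.smul_eq, norm_mul, norm_pow, Complex.norm_natCast,
    Real.mul_rpow (by positivity) (by positivity)] at h1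
  refine le_trans ?_ h1
  have hM1 : (1 : ℝ) ≤ (M : ℝ) ^ p :=
    Real.one_le_rpow (by exact_mod_cast Nat.one_le_iff_ne_zero.2 hM) hp.le
  have h2 : 0 ≤ (‖t‖ ^ j) ^ p * N (c j) := mul_nonneg (by positivity) (hN.nonneg _)
  nlinarith

end IsPHomogeneousSeminorm

namespace IsPNormedAlgebra

variable {B : Type*} [Ring B] [Algebra ℂ B] {p : ℝ} {N : B → ℝ}

theorem pow_le (hN : IsPNormedAlgebra B p N) (x : B) (k : ℕ) :
    N (x ^ k) ≤ max (N 1) 1 * N x ^ k := by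
  induction k with
  | zero => simp
  | succ k ih =>
    rw [pow_succ, pow_succ, ← mul_assoc]
    exact (hN.mul_le _ _).trans (mul_le_mul_of_nonneg_right ih (hN.nonneg _))

theorem natCast_smul_le (hN : IsPNormedAlgebra B p N) (n : ℕ) (x : B) :
    N ((n : ℂ) • x) = (n : ℝ) ^ p * N x := by
  rw [hN.smul_eq, Complex.norm_natCast]

end IsPNormedAlgebra

/-- On the ideal `I` the square of `N x` is controlled by `N (x ^ 2)`. -/
def SquareBounded {B : Type*} [Ring B] (N : B → ℝ) (I : Ideal B) (m : ℝ) : Prop :=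
  ∀ x ∈ I, N x ^ 2 ≤ m * N (x * x)

namespace SquareBounded

variable {B : Type*} [Ring B] [Algebra ℂ B] {p : ℝ} {N : B → ℝ} {I : Ideal B}
  {m : ℝ}

theorem pow_two_pow (hN : IsPNormedAlgebra B p N) (hm : 0 < m) (hI : SquareBounded N I m)
    {x : B} (hx : x ∈ I) (n : ℕ) : (N x / m) ^ 2 ^ n ≤ N (x ^ 2 ^ n) / m := by
  induction n with
  | zero => simp
  | succ n ih =>
    have h1 := hI _ (I.pow_mem_of_mem hx (2 ^ n) (by positivity))
    have h0 : 0 ≤ (N x / m) ^ 2 ^ n := pow_nonneg (div_nonneg (hN.nonneg _) hm.le) _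
    rw [pow_succ 2 n, pow_mul, pow_mul, pow_two (x ^ 2 ^ n)]
    calc ((N x / m) ^ 2 ^ n) ^ 2 ≤ (N (x ^ 2 ^ n) / m) ^ 2 := by gcongr
      _ = N (x ^ 2 ^ n) ^ 2 / m / m := by rw [div_pow]; field_simp
      _ ≤ (m * N (x ^ 2 ^ n * x ^ 2 ^ n)) / m / m := by gcongr
      _ = _ := by field_simp

theorem le_of_pow_le (hN : IsPNormedAlgebra B p N) (hm : 0 < m) (hI : SquareBounded N I m)
    {x : B} (hx : x ∈ I) {C q : ℝ} (d : ℕ) (hq : 0 ≤ q)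
    (h : ∀ k : ℕ, N (x ^ (k + 1)) ≤ C * (k + 2) ^ d * q ^ k) : N x ≤ m * q := by
  by_contra! hlt
  have hy : q < N x / m := by rw [lt_div_iff₀ hm]; linarith
  set y := N x / m with hydef
  have hy0 : 0 < y := hq.trans_lt hy
  have hr0 : 0 ≤ q / y := by positivity
  have hr1 : q / y < 1 := (div_lt_one hy0).2 hy
  have hC : 0 ≤ C := by
    have h0 := (hN.nonneg _).trans (h 0)
    have : (0 : ℝ) < ((0 : ℕ) + 2) ^ d := by positivity
    rw [pow_zero, mul_one] at h0
    exact nonneg_of_mul_nonneg_left h0 this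
  have lim1 := (tendsto_pow_const_mul_const_pow_of_abs_lt_one d
    (show |q / y| < 1 by rwa [abs_of_nonneg hr0])).const_mul (C * 3 ^ d / m)
  rw [mul_zero] at lim1
  have hbd : ∀ n : ℕ, 1 ≤ n →
      y ≤ C * 3 ^ d / m * (((2 ^ n - 1 : ℕ) : ℝ) ^ d * (q / y) ^ (2 ^ n - 1)) := by
    intro n hn
    have h2 : 2 ≤ 2 ^ n := by
      calc 2 = 2 ^ 1 := rfl
        _ ≤ 2 ^ n := Nat.pow_le_pow_right (by norm_num) hn
    obtain ⟨k, hk⟩ : ∃ k, 2 ^ n = k + 1 := ⟨2 ^ n - 1, by omega⟩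
    have hk1 : (1 : ℝ) ≤ k := by exact_mod_cast (show 1 ≤ k by omega)
    have h3 := pow_two_pow hN hm hI hx n
    rw [hk] at h3 ⊢
    rw [Nat.add_sub_cancel, div_pow]
    have h4 : y ^ (k + 1) ≤ C * (3 * k) ^ d * q ^ k / m := by
      refine h3.trans ?_
      gcongr
      refine (h k).trans ?_
      gcongr
      linarith
    have h5 : y = y ^ (k + 1) / y ^ k := by
      rw [pow_succ]
      field_simp
    calc y = y ^ (k + 1) / y ^ k := h5
      _ ≤ (C * (3 * k) ^ d * q ^ k / m) / y ^ k := by gcongr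
      _ = _ := by rw [mul_pow]; field_simp
  have lim2 : Tendsto (fun n : ℕ => 2 ^ n - 1) atTop atTop := by
    refine tendsto_atTop_mono (fun n => ?_) tendsto_id
    have := Nat.lt_two_pow_self (n := n)
    simp only [id]
    omega
  have := ge_of_tendsto (lim1.comp lim2) ((eventually_ge_atTop 1).mono hbd)
  exact hy0.not_ge this

theorem eq_zero_of_pow_eq_zero (hN : IsPNormedAlgebra B p N) (hm : 0 < m)
    (hI : SquareBounded N I m) {x : B} (hx : x ∈ I) {j : ℕ} (hj : x ^ j = 0) : x = 0 := by
  have h := pow_two_pow hN hm hI hx j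
  have h0 : x ^ 2 ^ j = 0 := pow_eq_zero_of_le Nat.lt_two_pow_self.le hj
  rw [h0, hN.map_zero hN.p_pos, zero_div] at h
  have h1 : N x / m = 0 :=
    pow_eq_zero_iff (by positivity) |>.1 (h.antisymm (pow_nonneg (div_nonneg (hN.nonneg _) hm.le) _))
  exact hN.eq_zero_of_map_eq_zero _ ((div_eq_zero_iff.1 h1).resolve_right hm.ne')

theorem mul_comm_le [I.IsTwoSided] (hN : IsPNormedAlgebra B p N) (hm : 0 < m) (hI : SquareBounded N I m)
    (x : B) {y : B} (hy : y ∈ I) : N (x * y) ≤ m * N (y * x) := by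
  refine le_of_pow_le hN hm hI (I.mul_mem_left x hy) (C := max (N 1) 1 * N x * N y) 0
    (hN.nonneg _) fun k => ?_
  have h1 : (x * y) ^ (k + 1) = x * (y * x) ^ k * y := by
    induction k with
    | zero => simp
    | succ k ih => rw [pow_succ, ih, pow_succ]; simp only [mul_assoc]
  rw [h1, pow_zero, mul_one]
  calc N (x * (y * x) ^ k * y) ≤ N x * N ((y * x) ^ k) * N y :=
        (hN.mul_le _ _).trans (mul_le_mul_of_nonneg_right (hN.mul_le _ _) (hN.nonneg _))
    _ ≤ N x * (max (N 1) 1 * N (y * x) ^ k) * N y := by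
        have := hN.pow_le (y * x) k
        have := hN.nonneg x
        have := hN.nonneg y
        gcongr
    _ = _ := by ring

end SquareBounded

/-- The powers of `x` grow at most like `α ^ (p * k)`, up to a polynomial factor. -/
def PowGrowth {B : Type*} [Ring B] (p : ℝ) (N : B → ℝ) (x : B) (α : ℝ) : Prop :=
  ∃ (C : ℝ) (d : ℕ), 0 ≤ C ∧ ∀ k : ℕ, N (x ^ k) ≤ C * (k + 1) ^ d * (α ^ k) ^ p

namespace PowGrowth

variable {B : Type*} [Ring B] [Algebra ℂ B] {p : ℝ} {N : B → ℝ}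

theorem self (hN : IsPNormedAlgebra B p N) (x : B) : PowGrowth p N x (N x ^ (1 / p)) := by
  refine ⟨max (N 1) 1, 0, by positivity, fun k => ?_⟩
  have h1 : ((N x ^ (1 / p)) ^ k) ^ p = N x ^ k := by
    rw [Real.rpow_pow_comm (hN.nonneg _), ← Real.rpow_mul (pow_nonneg (hN.nonneg _) _),
      one_div_mul_cancel hN.p_pos.ne', Real.rpow_one]
  rw [h1, pow_zero, mul_one]
  exact hN.pow_le x k

theorem zero (hN : IsPNormedAlgebra B p N) : PowGrowth p N 0 0 := by
  have := self hN 0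
  rwa [hN.map_zero hN.p_pos, Real.zero_rpow (one_div_ne_zero hN.p_pos.ne')] at this

theorem add (hN : IsPNormedAlgebra B p N) {x y : B} (hxy : Commute x y) {α β : ℝ}
    (hα : 0 ≤ α) (hβ : 0 ≤ β) (hx : PowGrowth p N x α) (hy : PowGrowth p N y β) :
    PowGrowth p N (x + y) (α + β) := by
  obtain ⟨C, d, hC, hx⟩ := hx
  obtain ⟨D, e, hD, hy⟩ := hy
  refine ⟨C * D, d + e + 1, by positivity, fun k => ?_⟩
  rw [hxy.add_pow]
  refine (hN.sum_le hN.p_pos _ _).trans ?_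
  calc _ ≤ ∑ i ∈ range (k + 1), C * D * ((k : ℝ) + 1) ^ (d + e) * ((α + β) ^ k) ^ p := by
        refine sum_le_sum fun i hi => ?_
        have hik : i ≤ k := Nat.lt_succ_iff.1 (mem_range.1 hi)
        have h1 : x ^ i * y ^ (k - i) * (k.choose i : B)
            = ((k.choose i : ℕ) : ℂ) • (x ^ i * y ^ (k - i)) := by
          rw [Nat.cast_smul_eq_nsmul, nsmul_eq_mul, Nat.cast_comm]
        rw [h1, hN.natCast_smul_le]
        have hi' : (i : ℝ) ≤ k := by exact_mod_cast hik
        have hki' : ((k - i : ℕ) : ℝ) ≤ k := by exact_mod_cast Nat.sub_le _ _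
        calc (k.choose i : ℝ) ^ p * N (x ^ i * y ^ (k - i))
            ≤ (k.choose i : ℝ) ^ p * (N (x ^ i) * N (y ^ (k - i))) := by
              gcongr
              exact hN.mul_le _ _
          _ ≤ (k.choose i : ℝ) ^ p * ((C * (i + 1) ^ d * (α ^ i) ^ p) *
                (D * ((k - i : ℕ) + 1) ^ e * (β ^ (k - i)) ^ p)) := by
              gcongr
              · exact hN.nonneg _
              · exact hx i
              · exact hy _
          _ = C * D * (((i : ℝ) + 1) ^ d * (((k - i : ℕ) : ℝ) + 1) ^ e) *
                (α ^ i * β ^ (k - i) * k.choose i) ^ p := by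
              rw [Real.mul_rpow (by positivity) (by positivity),
                Real.mul_rpow (by positivity) (by positivity)]
              ring
          _ ≤ C * D * (((k : ℝ) + 1) ^ d * ((k : ℝ) + 1) ^ e) * ((α + β) ^ k) ^ p := by
              have h2 : α ^ i * β ^ (k - i) * k.choose i ≤ (α + β) ^ k := by
                rw [add_pow]
                exact single_le_sum (f := fun i => α ^ i * β ^ (k - i) * (k.choose i : ℝ))
                  (fun i _ => by positivity) hi
              have := hN.p_pos
              gcongr
          _ = _ := by rw [pow_add]
    _ = _ := by
        rw [sum_const, card_range, nsmul_eq_mul, pow_succ]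
        push_cast
        ring

theorem sum (hN : IsPNormedAlgebra B p N) {ι : Type*} (s : Finset ι) (f : ι → B)
    (hf : ∀ i j, Commute (f i) (f j)) :
    PowGrowth p N (∑ i ∈ s, f i) (∑ i ∈ s, N (f i) ^ (1 / p)) := by
  classical
  induction s using Finset.induction_on with
  | empty => simpa using zero hN
  | insert i s hi ih =>
    rw [sum_insert hi, sum_insert hi]
    exact add hN (Commute.sum_right _ _ _ fun j _ => hf i j)
      (Real.rpow_nonneg (hN.nonneg _) _)
      (sum_nonneg fun j _ => Real.rpow_nonneg (hN.nonneg _) _) (self hN _) ih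

theorem le {I : Ideal B} {m : ℝ} (hN : IsPNormedAlgebra B p N) (hm : 0 < m)
    (hI : SquareBounded N I m) {x : B} (hxI : x ∈ I) {α : ℝ} (hα : 0 ≤ α)
    (hx : PowGrowth p N x α) : N x ≤ m * α ^ p := by
  obtain ⟨C, d, hC, hx⟩ := hx
  refine SquareBounded.le_of_pow_le hN hm hI hxI (C := C * α ^ p) d (by positivity) fun k => ?_
  refine (hx (k + 1)).trans_eq ?_
  have h1 : (α ^ (k + 1)) ^ p = α ^ p * (α ^ p) ^ k := by
    rw [pow_succ, Real.mul_rpow (by positivity) hα, ← Real.rpow_natCast, ← Real.rpow_natCast,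
      ← Real.rpow_mul hα, ← Real.rpow_mul hα, mul_comm p, mul_comm]
  rw [h1]
  push_cast
  ring

end PowGrowth


section Derivation

variable {B : Type*} [Ring B] [Algebra ℂ B]

/-- The inner derivation `x ↦ a * x - x * a`. -/
def innerDer (a : B) : Module.End ℂ B := LinearMap.mulLeft ℂ a - LinearMap.mulRight ℂ a

theorem innerDer_apply (a x : B) : innerDer a x = a * x - x * a := rfl

theorem innerDer_mul (a x y : B) : innerDer a (x * y) = innerDer a x * y + x * innerDer a y := by
  simp only [innerDer_apply]
  noncomm_ring

theorem innerDer_pow_mul (a x : B) {y : B} (hy : innerDer a (innerDer a y) = 0) (n : ℕ) :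
    (innerDer a ^ (n + 1)) (x * y) =
      (innerDer a ^ (n + 1)) x * y + (n + 1) • ((innerDer a ^ n) x * innerDer a y) := by
  induction n with
  | zero => simp [innerDer_mul]
  | succ n ih =>
    rw [pow_succ', Module.End.mul_apply, ih, map_add, innerDer_mul, map_nsmul, innerDer_mul, hy,
      mul_zero, add_zero, ← Module.End.mul_apply, ← pow_succ', ← Module.End.mul_apply,
      ← pow_succ', succ_nsmul _ (n + 1)]
    abel

theorem innerDer_pow_eq_zero (a : B) {c : B} (hc : innerDer a c = 0) (n : ℕ) :
    innerDer a (c ^ n) = 0 := by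
  induction n with
  | zero => simp [innerDer_apply]
  | succ n ih => rw [pow_succ, innerDer_mul, ih, hc, zero_mul, mul_zero, add_zero]

/-- The algebraic core of the Kleinecke–Shirokov theorem. -/
theorem innerDer_pow_pow (a : B) {y : B} (hy : innerDer a (innerDer a y) = 0) (n : ℕ) :
    (innerDer a ^ n) (y ^ n) = n.factorial • (innerDer a y) ^ n := by
  induction n with
  | zero => simp
  | succ n ih =>
    rw [pow_succ y, innerDer_pow_mul a _ hy, pow_succ' (innerDer a), Module.End.mul_apply, ih,
      map_nsmul, innerDer_pow_eq_zero a hy, smul_zero, zero_mul, zero_add, smul_mul_assoc,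
      smul_smul, ← pow_succ, Nat.factorial_succ]

/-- The coefficient of `z ^ j` in `(1 + z a) ^ n * b * (1 - z a) ^ n`. -/
noncomputable def conjCoeff (a b : B) (n j : ℕ) : B :=
  ∑ q ∈ antidiagonal j,
    ((n.choose q.1 : ℂ) * n.choose q.2 * (-1) ^ q.2) • (a ^ q.1 * b * a ^ q.2)

theorem one_add_smul_pow (a : B) (z : ℂ) (n : ℕ) :
    (1 + z • a) ^ n = ∑ k ∈ range (n + 1), (z ^ k * n.choose k) • a ^ k := by
  rw [add_comm, (Commute.one_right _).add_pow]
  refine sum_congr rfl fun k _ => ?_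
  rw [one_pow, mul_one, smul_pow, mul_smul, Nat.cast_smul_eq_nsmul, nsmul_eq_mul, Nat.cast_comm,
    smul_mul_assoc]

theorem sum_conjCoeff (a b : B) (n : ℕ) (z : ℂ) :
    (1 + z • a) ^ n * b * (1 - z • a) ^ n =
      ∑ j ∈ range (2 * n + 1), z ^ j • conjCoeff a b n j := by
  let f : ℕ × ℕ → B := fun q =>
    (z ^ (q.1 + q.2) * ((n.choose q.1 : ℂ) * n.choose q.2 * (-1) ^ q.2)) •
      (a ^ q.1 * b * a ^ q.2)
  have h1 : (1 + z • a) ^ n * b * (1 - z • a) ^ n =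
      ∑ q ∈ range (n + 1) ×ˢ range (n + 1), f q := by
    rw [sub_eq_add_neg, ← neg_smul, one_add_smul_pow, one_add_smul_pow, sum_mul, sum_mul_sum,
      sum_product]
    refine sum_congr rfl fun k _ => sum_congr rfl fun l _ => ?_
    simp only [f, smul_mul_assoc, mul_smul_comm, smul_smul]
    congr 1
    rw [neg_pow z, pow_add]
    ring
  rw [h1, ← sum_fiberwise_of_maps_to (t := range (2 * n + 1)) (g := fun q => q.1 + q.2)]
  · refine sum_congr rfl fun j _ => ?_
    rw [conjCoeff, smul_sum]
    calc _ = ∑ q ∈ antidiagonal j, f q := by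
          refine sum_subset (fun q hq => ?_) fun q hq hq' => ?_
          · exact mem_antidiagonal.2 (mem_filter.1 hq).2
          · have h2 : n < q.1 ∨ n < q.2 := by
              by_contra! h
              refine hq' (mem_filter.2 ⟨mem_product.2 ⟨?_, ?_⟩, mem_antidiagonal.1 hq⟩)
              · exact mem_range.2 (by omega)
              · exact mem_range.2 (by omega)
            rcases h2 with h2 | h2 <;> simp [f, Nat.choose_eq_zero_of_lt h2]
      _ = _ := by
          refine sum_congr rfl fun q hq => ?_
          simp only [f]
          rw [mem_antidiagonal.1 hq, mul_smul]
  · intro q hq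
    rw [mem_product, mem_range, mem_range] at hq
    exact mem_range.2 (by omega)

theorem innerDer_pow_apply (a b : B) (j : ℕ) :
    (innerDer a ^ j) b = (j.factorial : ℂ) •
      ∑ q ∈ antidiagonal j,
        ((1 / (q.1.factorial : ℂ)) * (1 / q.2.factorial) * (-1) ^ q.2) • (a ^ q.1 * b * a ^ q.2) := by
  have hc : Commute (LinearMap.mulLeft ℂ a) (-LinearMap.mulRight ℂ a) :=
    (LinearMap.commute_mulLeft_right (R := ℂ) a a).neg_right
  rw [innerDer, sub_eq_add_neg, hc.add_pow', LinearMap.sum_apply, smul_sum]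
  refine sum_congr rfl fun q hq => ?_
  rw [neg_pow (LinearMap.mulRight ℂ a), LinearMap.pow_mulLeft, LinearMap.pow_mulRight, smul_smul]
  have h1 : (j.factorial : ℂ) * ((1 / (q.1.factorial : ℂ)) * (1 / q.2.factorial) * (-1) ^ q.2)
      = (j.choose q.1 : ℂ) * (-1) ^ q.2 := by
    rw [← mem_antidiagonal.1 hq, Nat.choose_symm_add, Nat.add_choose, Nat.cast_div
      (Nat.factorial_mul_factorial_dvd_factorial_add _ _)
      (by exact_mod_cast mul_ne_zero (Nat.factorial_ne_zero _) (Nat.factorial_ne_zero _))]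
    push_cast
    field_simp
  rw [h1, mul_smul, Nat.cast_smul_eq_nsmul, LinearMap.smul_apply]
  congr 1
  rcases Nat.even_or_odd q.2 with h | h <;> simp [h.neg_one_pow, mul_assoc]

end Derivation

theorem tendsto_choose_div_pow (k : ℕ) :
    Tendsto (fun n : ℕ => (n.choose k : ℂ) / (n : ℂ) ^ k) atTop (𝓝 (1 / (k.factorial : ℂ))) := by
  have h1 : Tendsto (fun n : ℕ => (n : ℝ) * (1 / (n : ℝ))) atTop (𝓝 1) := by
    refine tendsto_const_nhds.congr' ?_
    filter_upwards [eventually_ne_atTop 0] with n hn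
    have : (n : ℝ) ≠ 0 := by exact_mod_cast hn
    field_simp
  have h2 := (Complex.continuous_ofReal.tendsto _).comp
    (ProbabilityTheory.tendsto_choose_mul_pow_atTop k h1)
  simp only [one_pow] at h2
  convert h2 using 2 with n
  · simp [div_eq_mul_inv]
  · simp

namespace SquareBounded

variable {B : Type*} [Ring B] [Algebra ℂ B] {p : ℝ} {N : B → ℝ} {I : Ideal B} [I.IsTwoSided]
  {m : ℝ}

theorem one_sub_pow_le (hN : IsPNormedAlgebra B p N) {a : B} (ha : N a ≤ 1 / 2) {z : ℂ} {n : ℕ}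
    (hz : n * ‖z‖ ^ 2 ≤ 1) : N ((1 + (-z ^ 2) • a ^ 2) ^ n) ≤ 2 * max (N 1) 1 := by
  rw [one_add_smul_pow]
  refine (hN.sum_le hN.p_pos _ _).trans ?_
  have hterm : ∀ k, N (((-z ^ 2) ^ k * (n.choose k : ℂ)) • (a ^ 2) ^ k) ≤
      max (N 1) 1 * (1 / 2) ^ k := by
    intro k
    rw [hN.smul_eq, ← pow_mul a]
    have h1 : ‖(-z ^ 2) ^ k * (n.choose k : ℂ)‖ ≤ 1 := by
      rw [norm_mul, norm_pow, norm_neg, norm_pow, Complex.norm_natCast]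
      have : (n.choose k : ℝ) ≤ (n : ℝ) ^ k := by exact_mod_cast Nat.choose_le_pow n k
      calc (‖z‖ ^ 2) ^ k * (n.choose k : ℝ) ≤ (‖z‖ ^ 2) ^ k * (n : ℝ) ^ k := by gcongr
        _ = (n * ‖z‖ ^ 2) ^ k := by rw [mul_pow]; ring
        _ ≤ 1 := pow_le_one₀ (by positivity) hz
    have h2 : N (a ^ (2 * k)) ≤ max (N 1) 1 * (1 / 2) ^ k := by
      refine (hN.pow_le _ _).trans ?_
      have h0 := hN.nonneg a
      gcongr
      rw [pow_mul]
      gcongr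
      nlinarith
    calc _ ≤ 1 * N (a ^ (2 * k)) := by
          gcongr
          · exact hN.nonneg _
          · exact Real.rpow_le_one (norm_nonneg _) h1 hN.p_pos.le
      _ ≤ _ := by rwa [one_mul]
  calc _ ≤ ∑ k ∈ range (n + 1), max (N 1) 1 * (1 / 2 : ℝ) ^ k := sum_le_sum fun k _ => hterm k
    _ = max (N 1) 1 * ∑ k ∈ range (n + 1), (1 / 2 : ℝ) ^ k := by rw [mul_sum]
    _ ≤ max (N 1) 1 * 2 := by
        gcongr
        exact sum_geometric_two_le _
    _ = _ := mul_comm _ _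

theorem conj_le (hN : IsPNormedAlgebra B p N) (hm : 0 < m) (hI : SquareBounded N I m)
    {a b : B} (ha : N a ≤ 1 / 2) (hb : b ∈ I) {z : ℂ} {n : ℕ} (hz : n * ‖z‖ ^ 2 ≤ 1) :
    N ((1 + z • a) ^ n * b * (1 - z • a) ^ n) ≤ m * (N b * (2 * max (N 1) 1)) := by
  rw [mul_assoc]
  refine (mul_comm_le hN hm hI _ (I.mul_mem_right _ hb)).trans ?_
  have h1 : (1 - z • a) ^ n * (1 + z • a) ^ n = (1 + (-z ^ 2) • a ^ 2) ^ n := by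
    have hc : Commute (1 - z • a) (1 + z • a) := by
      refine Commute.add_right (Commute.one_right _) ?_
      exact (Commute.one_left _).sub_left (Commute.refl _)
    rw [← hc.mul_pow, neg_smul, ← smul_pow]
    congr 1
    simp only [sub_mul, mul_add, one_mul, mul_one, pow_two]
    abel
  rw [mul_assoc, h1]
  refine mul_le_mul_of_nonneg_left ((hN.mul_le _ _).trans ?_) hm.le
  exact mul_le_mul_of_nonneg_left (one_sub_pow_le hN ha hz) (hN.nonneg _)

theorem conjCoeff_le (hN : IsPNormedAlgebra B p N) (hm : 0 < m) (hI : SquareBounded N I m)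
    {a b : B} (ha : N a ≤ 1 / 2) (hb : b ∈ I) {j r : ℕ} (hr : 1 ≤ r) (hj : j ≤ r) :
    N ((((r ^ 2 : ℕ) : ℂ) ^ j)⁻¹ • conjCoeff a b (r ^ 2) j) ≤
      (2 * r ^ 2 + 1) * (m * (N b * (2 * max (N 1) 1))) * (((r : ℝ) ^ j) ^ p)⁻¹ := by
  have hr0 : (0 : ℝ) < r := by exact_mod_cast hr
  have hrr : r ≤ r ^ 2 := Nat.le_self_pow (by norm_num) r
  have h := hN.toIsPHomogeneousSeminorm.coeff_le hN.p_pos (conjCoeff a b (r ^ 2))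
    (M := 2 * r ^ 2 + 1) ((r : ℂ)⁻¹) (K := m * (N b * (2 * max (N 1) 1))) (fun z hz => by
      rw [← sum_conjCoeff]
      refine conj_le hN hm hI ha hb ?_
      rw [hz, norm_inv, Complex.norm_natCast]
      push_cast
      rw [inv_pow, mul_inv_cancel₀ (by positivity)]) (j := j) (by omega)
  rw [norm_inv, Complex.norm_natCast, inv_pow, Real.inv_rpow (by positivity)] at h
  push_cast at h
  rw [hN.smul_eq, norm_inv, norm_pow, Complex.norm_natCast, Real.inv_rpow (by positivity)]
  push_cast
  have h2 : (((r : ℝ) ^ 2) ^ j) ^ p = ((r : ℝ) ^ j) ^ p * ((r : ℝ) ^ j) ^ p := by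
    rw [← Real.mul_rpow (by positivity) (by positivity)]
    congr 1
    ring
  rw [h2, mul_inv, mul_assoc, mul_comm]
  exact mul_le_mul_of_nonneg_right h (by positivity)

theorem innerDer_pow_eq_zero_of_le (hN : IsPNormedAlgebra B p N) (hm : 0 < m)
    (hI : SquareBounded N I m) {a b : B} (ha : N a ≤ 1 / 2) (hb : b ∈ I) {j : ℕ}
    (hj : 3 ≤ j * p) : (innerDer a ^ j) b = 0 := by
  rw [innerDer_pow_apply]
  set D : B := ∑ q ∈ antidiagonal j,
    ((1 / (q.1.factorial : ℂ)) * (1 / q.2.factorial) * (-1) ^ q.2) • (a ^ q.1 * b * a ^ q.2)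
    with hD
  suffices h : N D ≤ 0 by
    rw [hN.eq_zero_of_map_eq_zero D (h.antisymm (hN.nonneg _)), smul_zero]
  have hp := hN.p_pos
  set g : ℕ → B := fun n => ((n : ℂ) ^ j)⁻¹ • conjCoeff a b n j with hg
  have lim1 : Tendsto (fun n => N (D - g n)) atTop (𝓝 0) := by
    have hle : ∀ n, N (D - g n) ≤ ∑ q ∈ antidiagonal j,
        ‖(1 / (q.1.factorial : ℂ)) * (1 / q.2.factorial) * (-1) ^ q.2
          - (n.choose q.1 / (n : ℂ) ^ q.1) * (n.choose q.2 / (n : ℂ) ^ q.2) * (-1) ^ q.2‖ ^ p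
          * N (a ^ q.1 * b * a ^ q.2) := by
      intro n
      have : D - g n = ∑ q ∈ antidiagonal j,
        ((1 / (q.1.factorial : ℂ)) * (1 / q.2.factorial) * (-1) ^ q.2
          - (n.choose q.1 / (n : ℂ) ^ q.1) * (n.choose q.2 / (n : ℂ) ^ q.2) * (-1) ^ q.2) •
          (a ^ q.1 * b * a ^ q.2) := by
        rw [hD, hg]
        simp only [conjCoeff]
        rw [smul_sum, ← sum_sub_distrib]
        refine sum_congr rfl fun q hq => ?_
        rw [sub_smul, smul_smul, ← mem_antidiagonal.1 hq, pow_add, mul_inv]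
        congr 2
        simp only [div_eq_mul_inv]
        ring
      rw [this]
      refine (hN.sum_le hp _ _).trans_eq (sum_congr rfl fun q _ => hN.smul_eq _ _)
    refine squeeze_zero (fun n => hN.nonneg _) hle ?_
    rw [show (0 : ℝ) = ∑ q ∈ antidiagonal j, 0 ^ p * N (a ^ q.1 * b * a ^ q.2) by
      simp [Real.zero_rpow hp.ne']]
    refine tendsto_finsetSum _ fun q _ => Tendsto.mul_const _ ?_
    refine Tendsto.rpow_const ?_ (Or.inr hp.le)
    have := (((tendsto_choose_div_pow q.1).mul (tendsto_choose_div_pow q.2)).mul_const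
      ((-1 : ℂ) ^ q.2)).const_sub ((1 / (q.1.factorial : ℂ)) * (1 / q.2.factorial) * (-1) ^ q.2)
    rw [sub_self] at this
    simpa using this.norm
  have lim2 : Tendsto (fun r : ℕ => N (g (r ^ 2))) atTop (𝓝 0) := by
    set K := m * (N b * (2 * max (N 1) 1)) with hK
    have hK0 : 0 ≤ K := by
      have := hN.nonneg b
      positivity
    have h3 : Tendsto (fun r : ℕ => 3 * K * (r : ℝ)⁻¹) atTop (𝓝 0) := by
      simpa using tendsto_inv_atTop_nhds_zero_nat.const_mul (3 * K)
    refine squeeze_zero' (Eventually.of_forall fun r => hN.nonneg _) ?_ h3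
    filter_upwards [eventually_ge_atTop 1, eventually_ge_atTop j] with r hr hjr
    refine (conjCoeff_le hN hm hI ha hb hr hjr).trans ?_
    have hr1 : (1 : ℝ) ≤ r := by exact_mod_cast hr
    have h4 : (r : ℝ) ^ 3 ≤ ((r : ℝ) ^ j) ^ p := by
      rw [← Real.rpow_natCast _ j, ← Real.rpow_mul (by positivity), ← Real.rpow_natCast _ 3]
      exact Real.rpow_le_rpow_of_exponent_le hr1 (by exact_mod_cast hj)
    calc (2 * (r : ℝ) ^ 2 + 1) * K * (((r : ℝ) ^ j) ^ p)⁻¹ ≤ (3 * r ^ 2) * K * ((r : ℝ) ^ 3)⁻¹ := by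
          gcongr
          nlinarith
      _ = 3 * K * (r : ℝ)⁻¹ := by field_simp
  have lim3 := (lim1.comp (tendsto_pow_atTop (α := ℕ) two_ne_zero)).add lim2
  rw [add_zero] at lim3
  refine ge_of_tendsto lim3 (Eventually.of_forall fun r => ?_)
  have := hN.add_le (D - g (r ^ 2)) (g (r ^ 2))
  rwa [sub_add_cancel] at this

theorem innerDer_mem {a b : B} (hb : b ∈ I) : innerDer a b ∈ I :=
  I.sub_mem (I.mul_mem_left _ hb) (I.mul_mem_right _ hb)

theorem innerDer_pow_mem {a b : B} (hb : b ∈ I) (n : ℕ) : (innerDer a ^ n) b ∈ I := by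
  induction n with
  | zero => simpa
  | succ n ih =>
    rw [pow_succ', Module.End.mul_apply]
    exact innerDer_mem ih

theorem innerDer_eq_zero_of_le (hN : IsPNormedAlgebra B p N) (hm : 0 < m)
    (hI : SquareBounded N I m) {a b : B} (ha : N a ≤ 1 / 2) (hb : b ∈ I) :
    innerDer a b = 0 := by
  have hp := hN.p_pos
  obtain ⟨j, hj⟩ := exists_nat_ge (3 / p)
  rw [div_le_iff₀ hp] at hj
  have hj0 : 0 < j := Nat.pos_of_ne_zero (by rintro rfl; norm_num at hj)
  have step : ∀ y ∈ I, innerDer a (innerDer a y) = 0 → innerDer a y = 0 := by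
    intro y hy h
    have h1 := innerDer_pow_pow a h j
    rw [innerDer_pow_eq_zero_of_le hN hm hI ha (I.pow_mem_of_mem hy j hj0) hj,
      ← Nat.cast_smul_eq_nsmul ℂ, eq_comm,
      smul_eq_zero_iff_right (by exact_mod_cast Nat.factorial_ne_zero j)] at h1
    exact eq_zero_of_pow_eq_zero hN hm hI (innerDer_mem hy) h1
  have down : ∀ n : ℕ, (innerDer a ^ (n + 1)) b = 0 → innerDer a b = 0 := by
    intro n
    induction n with
    | zero => simp
    | succ n ih =>
      intro h
      rw [pow_succ', pow_succ', Module.End.mul_apply, Module.End.mul_apply] at h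
      apply ih
      rw [pow_succ', Module.End.mul_apply]
      exact step _ (innerDer_pow_mem hb n) h
  obtain ⟨i, rfl⟩ := Nat.exists_eq_succ_of_ne_zero hj0.ne'
  exact down i (innerDer_pow_eq_zero_of_le hN hm hI ha hb hj)

/-- If `N x ^ 2 ≤ m * N (x ^ 2)` on the ideal `I`, then the elements of `I` are central. -/
theorem commute (hN : IsPNormedAlgebra B p N) (hm : 0 < m) (hI : SquareBounded N I m)
    (a : B) {b : B} (hb : b ∈ I) : Commute a b := by
  obtain ⟨s, hs0, hs⟩ : ∃ s : ℂ, s ≠ 0 ∧ N (s • a) ≤ 1 / 2 := by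
    have hp := hN.p_pos
    have h0 := hN.nonneg a
    set u : ℝ := (1 / (2 * (N a + 1))) with hu
    have hu0 : 0 < u := by positivity
    refine ⟨((u ^ (1 / p) : ℝ) : ℂ), ?_, ?_⟩
    · exact_mod_cast (Real.rpow_pos_of_pos hu0 _).ne'
    · rw [hN.smul_eq, Complex.norm_real, Real.norm_of_nonneg (by positivity),
        ← Real.rpow_mul hu0.le, one_div_mul_cancel hp.ne', Real.rpow_one, hu, div_mul_eq_mul_div,
        div_le_div_iff₀ (by positivity) (by positivity)]
      linarith
  have h := innerDer_eq_zero_of_le hN hm hI hs hb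
  rw [innerDer_apply, smul_mul_assoc, mul_smul_comm, ← smul_sub,
    smul_eq_zero_iff_right hs0, sub_eq_zero] at h
  exact h

theorem sum_le (hN : IsPNormedAlgebra B p N) (hm : 0 < m) (hI : SquareBounded N I m)
    {ι : Type*} (s : Finset ι) (f : ι → B) (hf : ∀ i, f i ∈ I) :
    N (∑ i ∈ s, f i) ≤ m * (∑ i ∈ s, N (f i) ^ (1 / p)) ^ p :=
  PowGrowth.le hN hm hI (I.sum_mem fun i _ => hf i)
    (sum_nonneg fun _ _ => Real.rpow_nonneg (hN.nonneg _) _)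
    (PowGrowth.sum hN s f fun i j => commute hN hm hI (f i) (hf j))

end SquareBounded

section Unitization

/-- The extension of a `p`-homogeneous norm to the unitization. -/
noncomputable def unitizationNorm {A : Type*} (p : ℝ) (N : A → ℝ) (x : Unitization ℂ A) : ℝ :=
  ‖x.fst‖ ^ p + N x.snd

theorem unitizationNorm_inr {A : Type*} [Zero A] {p : ℝ} {N : A → ℝ} (hp : 0 < p)
    (a : A) : unitizationNorm p N (a : Unitization ℂ A) = N a := by
  simp [unitizationNorm, Real.zero_rpow hp.ne']

variable {A : Type*} [NonUnitalRing A] [Module ℂ A] [IsScalarTower ℂ A A] [SMulCommClass ℂ A A]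
  {p : ℝ} {N : A → ℝ}

theorem IsPNormedAlgebra.unitization (hN : IsPNormedAlgebra A p N) :
    IsPNormedAlgebra (Unitization ℂ A) p (unitizationNorm p N) where
  p_pos := hN.p_pos
  p_le_one := hN.p_le_one
  nonneg x := add_nonneg (by positivity) (hN.nonneg _)
  add_le x y := by
    have h1 : ‖x.fst + y.fst‖ ^ p ≤ ‖x.fst‖ ^ p + ‖y.fst‖ ^ p :=
      (Real.rpow_le_rpow (norm_nonneg _) (norm_add_le _ _) hN.p_pos.le).trans
        (Real.rpow_add_le_add_rpow (norm_nonneg _) (norm_nonneg _) hN.p_pos.le hN.p_le_one)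
    have h2 := hN.add_le x.snd y.snd
    simp only [unitizationNorm, Unitization.fst_add, Unitization.snd_add]
    linarith
  smul_eq c x := by
    simp only [unitizationNorm, Unitization.fst_smul, Unitization.snd_smul, smul_eq_mul, norm_mul,
      hN.smul_eq, Real.mul_rpow (norm_nonneg _) (norm_nonneg _), mul_add]
  mul_le x y := by
    simp only [unitizationNorm, Unitization.fst_mul, Unitization.snd_mul, norm_mul,
      Real.mul_rpow (norm_nonneg _) (norm_nonneg _)]
    have h1 := hN.add_le (x.fst • y.snd + y.fst • x.snd) (x.snd * y.snd)
    have h2 := hN.add_le (x.fst • y.snd) (y.fst • x.snd)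
    have h3 := hN.mul_le x.snd y.snd
    rw [hN.smul_eq, hN.smul_eq] at h2
    linarith
  eq_zero_of_map_eq_zero x hx := by
    have h1 : 0 ≤ ‖x.fst‖ ^ p := by positivity
    have h2 := hN.nonneg x.snd
    simp only [unitizationNorm] at hx
    have h3 : ‖x.fst‖ ^ p = 0 := by linarith
    rw [Real.rpow_eq_zero (norm_nonneg _) hN.p_pos.ne', norm_eq_zero] at h3
    exact Unitization.ext h3 (hN.eq_zero_of_map_eq_zero _ (by linarith))

theorem IsPNormedAlgebra.sum_le_of_sq_le (hN : IsPNormedAlgebra A p N) {m : ℝ} (hm : 0 < m)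
    (h : ∀ a, N a ^ 2 ≤ m * N (a * a)) {ι : Type*} (s : Finset ι) (f : ι → A) :
    N (∑ i ∈ s, f i) ≤ m * (∑ i ∈ s, N (f i) ^ (1 / p)) ^ p := by
  have hI : SquareBounded (unitizationNorm p N)
      (RingHom.ker (Unitization.fstHom ℂ A)) m := by
    intro x hx
    obtain ⟨a, rfl⟩ : ∃ a : A, (a : Unitization ℂ A) = x :=
      ⟨x.snd, Unitization.ext (by simpa using hx.symm) (by simp)⟩
    rw [← Unitization.inr_mul, unitizationNorm_inr hN.p_pos, unitizationNorm_inr hN.p_pos]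
    exact h a
  have key := hI.sum_le hN.unitization hm s (fun i => (f i : Unitization ℂ A))
    (fun i => by simp [RingHom.mem_ker])
  have hsum : ∑ i ∈ s, (f i : Unitization ℂ A) = ((∑ i ∈ s, f i : A) : Unitization ℂ A) :=
    (map_sum (Unitization.inrHom ℂ ℂ A) f s).symm
  simpa only [hsum, unitizationNorm_inr hN.p_pos] using key

end Unitization

theorem supportSeminorm_le {A : Type*} [AddCommMonoid A] (p : ℝ) {N : A → ℝ}
    (hN : ∀ a, 0 ≤ N a) (a : A) : supportSeminorm p N a ≤ N a ^ (1 / p) :=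
  csInf_le (supportValues_bddBelow p N hN a) ⟨1, le_rfl, fun _ => a, by simp, by simp⟩

theorem supportSeminorm_nonneg {A : Type*} [AddCommMonoid A] (p : ℝ) {N : A → ℝ}
    (hN : ∀ a, 0 ≤ N a) (a : A) : 0 ≤ supportSeminorm p N a := by
  refine le_csInf (supportValues_nonempty p N a) ?_
  rintro s ⟨n, -, b, -, rfl⟩
  exact sum_nonneg fun i _ => Real.rpow_nonneg (hN _) _

theorem IsPNormedAlgebra.rpow_le_supportSeminorm {A : Type*} [NonUnitalRing A] [Module ℂ A]
    [IsScalarTower ℂ A A] [SMulCommClass ℂ A A] {p : ℝ} {N : A → ℝ}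
    (hN : IsPNormedAlgebra A p N) {m : ℝ} (hm : 0 < m)
    (h : ∀ a, N a ^ 2 ≤ m * N (a * a)) (a : A) :
    N a ^ (1 / p) ≤ m ^ (1 / p) * supportSeminorm p N a := by
  have hp := hN.p_pos
  rw [← div_le_iff₀' (by positivity)]
  refine le_csInf (supportValues_nonempty p N a) ?_
  rintro s ⟨n, -, b, rfl, rfl⟩
  have hs : 0 ≤ ∑ i, N (b i) ^ (1 / p) := sum_nonneg fun i _ => Real.rpow_nonneg (hN.nonneg _) _
  rw [div_le_iff₀' (by positivity)]
  calc _ ≤ (m * (∑ i, N (b i) ^ (1 / p)) ^ p) ^ (1 / p) :=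
        Real.rpow_le_rpow (hN.nonneg _) (hN.sum_le_of_sq_le hm h _ _) (by positivity)
    _ = _ := by
        rw [Real.mul_rpow hm.le (by positivity), ← Real.rpow_mul hs,
          mul_one_div_cancel hp.ne', Real.rpow_one]

theorem theorem4p1 {A : Type*} [NonUnitalRing A] [Module ℂ A]
    [IsScalarTower ℂ A A] [SMulCommClass ℂ A A]
    (p : ℝ) (N : A → ℝ) (hN : IsPNormedAlgebra A p N) :
    (∀ m : ℝ, 0 < m → (∀ a : A, N a ^ 2 ≤ m * N (a * a)) →
      ∀ a : A,
        supportSeminorm p N a ≤ N a ^ (1 / p) ∧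
        N a ^ (1 / p) ≤ m ^ (1 / p) * supportSeminorm p N a ∧
        supportSeminorm p N a ^ 2 ≤ m ^ (2 / p) * supportSeminorm p N (a * a)) ∧
    ((∀ a : A, N (a * a) = N a ^ 2) →
      ∀ a : A, supportSeminorm p N a = N a ^ (1 / p)) := by
  have hp := hN.p_pos
  refine ⟨fun m hm h a => ⟨supportSeminorm_le p hN.nonneg a,
    hN.rpow_le_supportSeminorm hm h a, ?_⟩, fun h a => ?_⟩
  · calc supportSeminorm p N a ^ 2 ≤ (N a ^ (1 / p)) ^ 2 :=
          pow_le_pow_left₀ (supportSeminorm_nonneg p hN.nonneg a)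
            (supportSeminorm_le p hN.nonneg a) 2
      _ = (N a ^ 2) ^ (1 / p) := Real.rpow_pow_comm (hN.nonneg _) _ _
      _ ≤ (m * N (a * a)) ^ (1 / p) :=
          Real.rpow_le_rpow (by positivity) (h a) (by positivity)
      _ = m ^ (1 / p) * N (a * a) ^ (1 / p) := Real.mul_rpow hm.le (hN.nonneg _)
      _ ≤ m ^ (1 / p) * (m ^ (1 / p) * supportSeminorm p N (a * a)) := by
          gcongr
          exact hN.rpow_le_supportSeminorm hm h _
      _ = m ^ (2 / p) * supportSeminorm p N (a * a) := by
          rw [← mul_assoc, ← Real.rpow_add hm]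
          congr 2
          ring
  · refine (supportSeminorm_le p hN.nonneg a).antisymm ?_
    simpa using hN.rpow_le_supportSeminorm one_pos (fun a => by rw [h a, one_mul]) a
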